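/- Let $d\ge 0$ be an integer, $[d]=\{1,\dots,d\}$, and let $e_1,\dots,e_d$ be the standard basis of $\mathbb{R}^d$. Let $\Delta_\emptyset=\{0\}$ and $\Delta_I=\operatorname{conv}\{e_i : i\in I\}$ for $\emptyset\ne I\subseteq[d]$. A polytope $R\subset\mathbb{R}^d$ is a *generalized permutahedron* if there are $\lambda>0$ and a polytope $P$ with $P+R=\lambda\Pi_d$ (Minkowski sum), where $\Pi_d=\operatorname{conv}\{(\sigma(1),\dots,\sigma(d)) : \sigma\in S_d\}$. For real coefficients $\{y_I\}_{I\subseteq[d]}$, the signed Minkowski sum $\sum_{I\subseteq[d]} y_I\Delta_I$ *defines* the polytope $R$ if $$R+\sum_{I:\,y_I<0}(-y_I)\Delta_I=\sum_{I:\,y_I\ge 0}y_I\Delta_I .$$ **Theorem.** Let $\{y_I\}_{I\subseteq[d]}$ be a vector of real numbers. The following are equivalent. (i) The signed Minkowski sum $\sum_{I\subseteq[d]}y_I\Delta_I$ defines a generalized permutahedron. (ii) For every $2$-element subset $E\subseteq[d]$ and every $T$ with $E\subseteq T\subseteq[d]$, $$\sum_{E\subseteq I\subseteq T}y_I\ \ge\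 0 .\qquad(*)$$ In particular, the set $C\subseteq\mathbb{R}^{2^{[d]}}$ of all vectors $\{y_I\}_{I\subseteq[d]}$ satisfying (i) is a polyhedral cone (an intersection of finitely many closed linear half-spaces). The inequalities $(*)$ are exactly its facets: for each pair $(E,T)$ the set of those $y\in C$ with equality in $(*)$ is a facet of $C$ (a face of dimension $\dim C-1$), and every facet of $C$ arises in this way from exactly one pair $(E,T)$. Moreover, $C$ is the image of the cone of supermodular functions $z:2^{[d]}\to\mathbb{R}$ (those with $z_I+z_J\le z_{I\cup J}+z_{I\cap J}$ for all $I,J\subseteq[d]$) under the linear bijection $U:\mathbb{R}^{2^{[d]}}\to\mathbb{R}^{2^{[d]}}$, $U(z)_I=\sum_{J\subseteq I}(-1)^{|I|-|J|}z_J$. -/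

import Mathlib

open scoped Pointwise

noncomputable section

namespace GenPerm

/-- A polytope in `ℝ^d`: the convex hull of finitely many points. -/
def IsPolytope {d : ℕ} (P : Set (Fin d → ℝ)) : Prop :=
  ∃ S : Finset (Fin d → ℝ), P = convexHull ℝ (S : Set (Fin d → ℝ))

/-- `R` is a Minkowski summand of `Q`: both are polytopes and `P + R = Q` for some polytope `P`
(`+` on sets is the Minkowski sum). -/
def IsMinkowskiSummand {d : ℕ} (R Q : Set (Fin d → ℝ)) : Prop :=
  IsPolytope R ∧ IsPolytope Q ∧ ∃ P : Set (Fin d → ℝ), IsPolytope P ∧ P + R = Q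

/-- `R` is a weak Minkowski summand of `Q`: a Minkowski summand of a dilate `l Q`, `l > 0`. -/
def IsWeakMinkowskiSummand {d : ℕ} (R Q : Set (Fin d → ℝ)) : Prop :=
  ∃ l : ℝ, 0 < l ∧ IsMinkowskiSummand R (l • Q)

/-- The standard permutahedron: the convex hull of all `(σ(1), …, σ(d))`. Since `Fin d` is
`{0, …, d-1}`, the values are shifted by one. -/
def permutahedron (d : ℕ) : Set (Fin d → ℝ) :=
  convexHull ℝ (Set.range fun (σ : Equiv.Perm (Fin d)) (i : Fin d) => ((σ i : ℕ) : ℝ) + 1)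

/-- A generalized permutahedron: a polytope that is a weak Minkowski summand of the
permutahedron. -/
def IsGeneralizedPermutahedron {d : ℕ} (P : Set (Fin d → ℝ)) : Prop :=
  IsPolytope P ∧ IsWeakMinkowskiSummand P (permutahedron d)

/-- The standard simplex `Δ_I`, the convex hull of the `e_i`, `i ∈ I`, with `Δ_∅ = {0}`. -/
def simplex {d : ℕ} (I : Finset (Fin d)) : Set (Fin d → ℝ) :=
  if I = ∅ then {0} else
    convexHull ℝ ((fun i : Fin d => (Pi.single i 1 : Fin d → ℝ)) '' (I : Set (Fin d)))

/-- The signed Minkowski sum `∑ y_I Δ_I` defines the polytope `R`: the sum `P` of the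
`(-y_I) Δ_I` with `y_I < 0` is a Minkowski summand of the sum `Q` of the `y_I Δ_I` with `y_I ≥ 0`,
and `R` is the Minkowski difference `Q - P`, that is, `R + P = Q`. -/
def SignedSumDefines {d : ℕ} (y : Finset (Fin d) → ℝ) (R : Set (Fin d → ℝ)) : Prop :=
  IsPolytope R ∧
    R + ∑ I : Finset (Fin d) with y I < 0, (-y I) • simplex I =
      ∑ I : Finset (Fin d) with 0 ≤ y I, y I • simplex I

/-- The signed Minkowski sum `∑ y_I Δ_I` defines a generalized permutahedron. -/
def DefinesGeneralizedPermutahedron {d : ℕ} (y : Finset (Fin d) → ℝ) : Prop :=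
  ∃ R : Set (Fin d → ℝ), SignedSumDefines y R ∧ IsGeneralizedPermutahedron R

/-- A polyhedral cone: an intersection of finitely many closed linear half-spaces. -/
def IsPolyhedral {V : Type*} [AddCommGroup V] [Module ℝ V] (C : PointedCone ℝ V) : Prop :=
  C.DualFG (LinearMap.id : Module.Dual ℝ V →ₗ[ℝ] Module.Dual ℝ V)

/-- `F` is a facet of the cone `C`: a face of dimension one less than that of `C`. -/
def IsFacetOf {V : Type*} [AddCommGroup V] [Module ℝ V] (F C : PointedCone ℝ V) : Prop :=
  F.IsFaceOf C ∧
    Module.finrank ℝ (Submodule.span ℝ (F : Set V)) + 1 =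
      Module.finrank ℝ (Submodule.span ℝ (C : Set V))

/-- The cone of supermodular functions `z : 2^[d] → ℝ`. -/
def supermodularCone (d : ℕ) : PointedCone ℝ (Finset (Fin d) → ℝ) where
  carrier := {z | ∀ I J : Finset (Fin d), z I + z J ≤ z (I ∪ J) + z (I ∩ J)}
  zero_mem' := by simp
  add_mem' := by
    intro a b ha hb I J
    have h1 := ha I J
    have h2 := hb I J
    simp only [Pi.add_apply]
    linarith
  smul_mem' := by
    intro c z hz I J
    have h := mul_le_mul_of_nonneg_left (hz I J) c.2
    change (c : ℝ) * z I + (c : ℝ) * z J ≤ (c : ℝ) * z (I ∪ J) + (c : ℝ) * z (I ∩ J)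
    linarith

/-- Möbius inversion, `y_I = ∑_{J ⊆ I} (-1)^{|I| - |J|} z_J`. -/
def moebius (d : ℕ) : (Finset (Fin d) → ℝ) →ₗ[ℝ] (Finset (Fin d) → ℝ) where
  toFun z I := ∑ J ∈ I.powerset, (-1 : ℝ) ^ (I.card - J.card) * z J
  map_add' a b := by
    funext I
    simp [mul_add, Finset.sum_add_distrib]
  map_smul' c z := by
    funext I
    simp only [Pi.smul_apply, smul_eq_mul, RingHom.id_apply, Finset.mul_sum]
    exact Finset.sum_congr rfl fun J _ => by ring

end GenPerm

end

/-!
The lower support function of `Δ_I` in direction `1_J` is the indicator of `I ⊆ J`, so for a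
polytope `R` defined by `∑ y_I Δ_I` the minimum of `x(J) = ∑_{i ∈ J} x_i` over `R` is
`f(J) = z_J - z_∅`, where `z_J = ∑_{I ⊆ J} y_I` is the inverse Möbius transform of `y`. The sum
over an interval `[E, T]` with `|E| = 2` is the second difference of `z` on the square below `T` in
the directions `E` (`sum_Icc_insert`), so the inequalities say exactly that `z` is supermodular
(`supermodular_zeta_iff`).

If `z` is supermodular, all the polytopes involved are base polytopes
`B(f) = {x | x([d]) = f([d]), x(J) ≥ f(J)}` of supermodular functions: the simplices
(`simplex_eq_basePolytope`) and the permutahedron (`permutahedron_eq_basePolytope`, for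
`f(J) = |J| (|J| + 1) / 2`). The greedy algorithm identifies `B(f)` with the convex hull of points
that depend linearly on `f` (`basePolytope_eq_convexHull`), which makes `f ↦ B(f)` additive
(`basePolytope_add`). Hence the signed sum defines `B(z - z_∅)`, and this is a summand of a large
dilate of the permutahedron because the second differences of `|J| (|J| + 1) / 2` are all `1`.
Conversely, every dilate of the permutahedron has a point minimizing `x(I ∩ J)` and `x(I ∪ J)`
simultaneously, hence so has every weak summand `R`, and at that point `r(I ∩ J) + r(I ∪ J) =
r(I) + r(J)` gives supermodularity.

For the facets, `y = 1` satisfies all inequalities strictly, and for each `(E, T)` some vector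
satisfies that one with equality and all others strictly (`exists_intervalSum_eq_zero`). The
inequalities are therefore irredundant, and the facets of a full-dimensional cone given by finitely
many irredundant inequalities are exactly its intersections with their hyperplanes
(`isFacetOf_zeroFace`, `IsFacetOf.exists_eq_zeroFace`, `zeroFace_injective`).
-/

/-! ### Möbius inversion and supermodularity -/

namespace GenPerm

variable {d : ℕ}

/-- The zeta transform `z_S = ∑_{I ⊆ S} y_I`, the inverse of Möbius inversion. -/
def zeta (y : Finset (Fin d) → ℝ) (S : Finset (Fin d)) : ℝ :=
  ∑ I ∈ S.powerset, y I

lemma moebius_apply (z : Finset (Fin d) → ℝ) (I : Finset (Fin d)) :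
    moebius d z I = ∑ J ∈ I.powerset, (-1 : ℝ) ^ (I.card - J.card) * z J := rfl

lemma moebius_insert (z : Finset (Fin d) → ℝ) {a : Fin d} {I : Finset (Fin d)} (ha : a ∉ I) :
    moebius d z (insert a I) = moebius d (fun J => z (insert a J)) I - moebius d z I := by
  simp only [moebius_apply]
  rw [Finset.sum_powerset_insert ha, add_comm, sub_eq_add_neg, ← Finset.sum_neg_distrib]
  congr 1
  · refine Finset.sum_congr rfl fun J hJ => ?_
    rw [Finset.mem_powerset] at hJ
    rw [Finset.card_insert_of_notMem ha, Finset.card_insert_of_notMem (fun h => ha (hJ h)),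
      Nat.add_sub_add_right]
  · refine Finset.sum_congr rfl fun J hJ => ?_
    rw [Finset.mem_powerset] at hJ
    rw [Finset.card_insert_of_notMem ha, Nat.succ_sub (Finset.card_le_card hJ), pow_succ]
    ring

lemma zeta_moebius (z : Finset (Fin d) → ℝ) : zeta (moebius d z) = z := by
  funext S
  induction S using Finset.induction_on generalizing z with
  | empty => simp [zeta, moebius_apply]
  | insert a S ha ih =>
    rw [← ih fun J => z (insert a J)]
    unfold zeta
    rw [Finset.sum_powerset_insert ha, ← Finset.sum_add_distrib]
    refine Finset.sum_congr rfl fun I hI => ?_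
    rw [moebius_insert z fun h => ha (Finset.mem_powerset.1 hI h)]
    ring

lemma moebius_bijective (d : ℕ) : Function.Bijective (moebius d) := by
  have h : Function.Injective (moebius d) := fun a b hab => by
    rw [← zeta_moebius a, hab, zeta_moebius]
  exact ⟨h, LinearMap.injective_iff_surjective.1 h⟩

lemma moebius_zeta (y : Finset (Fin d) → ℝ) : moebius d (zeta y) = y := by
  obtain ⟨z, rfl⟩ := (moebius_bijective d).2 y
  rw [zeta_moebius]

lemma sum_Icc_insert (y : Finset (Fin d) → ℝ) {A : Finset (Fin d)} {i j : Fin d}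
    (hi : i ∉ A) (hj : j ∉ A) (hij : i ≠ j) :
    ∑ I ∈ Finset.Icc {i, j} (insert i (insert j A)), y I =
      zeta y (insert i (insert j A)) + zeta y A - zeta y (insert i A) - zeta y (insert j A) := by
  have hi' : i ∉ insert j A := by simp [hij, hi]
  have hsub : ({i, j} : Finset (Fin d)) ⊆ insert i (insert j A) := by
    intro x; simp; tauto
  have hsd : insert i (insert j A) \ {i, j} = A := by
    ext x
    simp only [Finset.mem_sdiff, Finset.mem_insert, Finset.mem_singleton, not_or]
    constructor
    · tauto
    · intro hx
      exact ⟨by tauto, fun h => hi (h ▸ hx), fun h => hj (h ▸ hx)⟩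
  rw [Finset.Icc_eq_image_powerset hsub, hsd, Finset.sum_image]
  · unfold zeta
    rw [Finset.sum_powerset_insert hi', Finset.sum_powerset_insert hj,
      Finset.sum_powerset_insert hi, Finset.sum_powerset_insert hj]
    have h : ∀ I : Finset (Fin d), {i, j} ∪ I = insert i (insert j I) := by
      intro I; ext x; simp
    simp only [h]
    ring
  · intro I hI J hJ h
    simp only [Finset.coe_powerset, Set.mem_preimage, Set.mem_powerset_iff,
      Finset.coe_subset] at hI hJ
    ext x
    have hx := congrArg (x ∈ ·) h
    simp only [Finset.mem_union, Finset.mem_insert, Finset.mem_singleton, eq_iff_iff] at hx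
    have hxi : x ∈ I → ¬(x = i ∨ x = j) := fun hmem h => by
      rcases h with rfl | rfl
      exacts [hi (hI hmem), hj (hI hmem)]
    have hxj : x ∈ J → ¬(x = i ∨ x = j) := fun hmem h => by
      rcases h with rfl | rfl
      exacts [hi (hJ hmem), hj (hJ hmem)]
    tauto

lemma exists_eq_insert_insert {E T : Finset (Fin d)} (hE : E.card = 2) (hET : E ⊆ T) :
    ∃ (A : Finset (Fin d)) (i j : Fin d), i ∉ A ∧ j ∉ A ∧ i ≠ j ∧ E = {i, j} ∧
      T = insert i (insert j A) := by
  obtain ⟨i, j, hij, rfl⟩ := Finset.card_eq_two.1 hE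
  refine ⟨T \ {i, j}, i, j, by simp, by simp, hij, rfl, ?_⟩
  have hi : i ∈ T := hET (by simp)
  have hj : j ∈ T := hET (by simp)
  ext x
  simp only [Finset.mem_insert, Finset.mem_sdiff, Finset.mem_singleton]
  constructor
  · tauto
  · rintro (rfl | rfl | h) <;> tauto

lemma insert_union_insert (A : Finset (Fin d)) (i j : Fin d) :
    insert i A ∪ insert j A = insert i (insert j A) := by
  ext x; simp; tauto

lemma insert_inter_insert {A : Finset (Fin d)} {i j : Fin d} (hi : i ∉ A) (hj : j ∉ A)
    (hij : i ≠ j) : insert i A ∩ insert j A = A := by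
  ext x
  simp only [Finset.mem_inter, Finset.mem_insert]
  constructor
  · rintro ⟨rfl | h1, rfl | h2⟩ <;> tauto
  · tauto

/-- The function `f` on subsets of `[d]` is supermodular. -/
def Supermodular (f : Finset (Fin d) → ℝ) : Prop :=
  ∀ I J : Finset (Fin d), f I + f J ≤ f (I ∪ J) + f (I ∩ J)

/-- Supermodularity only has to be checked on the squares `A, A ∪ {i}, A ∪ {j}, A ∪ {i, j}`. -/
lemma supermodular_of_insert {f : Finset (Fin d) → ℝ}
    (h : ∀ (A : Finset (Fin d)) (i j : Fin d), i ∉ A → j ∉ A → i ≠ j →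
      f (insert i A) + f (insert j A) ≤ f (insert i (insert j A)) + f A) :
    Supermodular f := by
  -- the increment of `f` in direction `i` grows when the set grows
  have h1 : ∀ (A B : Finset (Fin d)) (i : Fin d), i ∉ A → i ∉ B →
      f (insert i A) + f (A ∪ B) ≤ f (insert i (A ∪ B)) + f A := by
    intro A B i hA hB
    induction B using Finset.induction_on with
    | empty => simp
    | insert j B hj ih =>
      have hij : i ≠ j := fun h => hB (by simp [h])
      have hiB : i ∉ B := fun h => hB (by simp [h])
      have ih := ih hiB
      rw [Finset.union_insert]
      by_cases hjA : j ∈ A ∪ B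
      · rw [Finset.insert_eq_of_mem hjA]; exact ih
      · have := h (A ∪ B) i j (by simp [hA, hiB]) hjA hij
        linarith
  have h2 : ∀ A B C : Finset (Fin d), Disjoint A C → Disjoint B C →
      f (A ∪ C) + f (A ∪ B) ≤ f (A ∪ B ∪ C) + f A := by
    intro A B C hA hB
    induction C using Finset.induction_on with
    | empty => simp [add_comm]
    | insert i C hi ih =>
      rw [Finset.disjoint_insert_right] at hA hB
      have ih := ih hA.2 hB.2
      have := h1 (A ∪ C) B i (by simp [hA.1, hi]) hB.1
      rw [Finset.union_insert, Finset.union_insert]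
      rw [Finset.union_right_comm] at this
      linarith
  intro I J
  have h3 := h2 (I ∩ J) (J \ I) (I \ J)
    (Finset.disjoint_left.2 fun x => by simp; tauto)
    (Finset.disjoint_left.2 fun x => by simp; tauto)
  have e1 : I ∩ J ∪ I \ J = I := by ext x; simp; tauto
  have e2 : I ∩ J ∪ J \ I = J := by ext x; simp; tauto
  have e3 : J ∪ I \ J = I ∪ J := by ext x; simp; tauto
  rwa [e2, e1, e3] at h3

lemma Supermodular.insert_insert {f : Finset (Fin d) → ℝ} (hf : Supermodular f)
    {A : Finset (Fin d)} {i j : Fin d} (hi : i ∉ A) (hj : j ∉ A) (hij : i ≠ j) :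
    f (insert i A) + f (insert j A) ≤ f (insert i (insert j A)) + f A := by
  have h := hf (insert i A) (insert j A)
  rwa [insert_union_insert, insert_inter_insert hi hj hij] at h

lemma supermodular_zeta_iff (y : Finset (Fin d) → ℝ) :
    Supermodular (zeta y) ↔
      ∀ E T : Finset (Fin d), E.card = 2 → E ⊆ T → 0 ≤ ∑ I ∈ Finset.Icc E T, y I := by
  constructor
  · intro h E T hE hET
    obtain ⟨A, i, j, hi, hj, hij, rfl, rfl⟩ := exists_eq_insert_insert hE hET
    rw [sum_Icc_insert y hi hj hij]
    have := h.insert_insert hi hj hij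
    linarith
  · refine fun h => supermodular_of_insert fun A i j hi hj hij => ?_
    have := h {i, j} (insert i (insert j A)) (Finset.card_pair hij) (by intro x; simp; tauto)
    rw [sum_Icc_insert y hi hj hij] at this
    linarith

lemma Supermodular.add {f g : Finset (Fin d) → ℝ} (hf : Supermodular f) (hg : Supermodular g) :
    Supermodular (f + g) := fun I J => by
  have := hf I J
  have := hg I J
  simp only [Pi.add_apply]
  linarith

lemma Supermodular.smul {f : Finset (Fin d) → ℝ} (hf : Supermodular f) {c : ℝ} (hc : 0 ≤ c) :
    Supermodular (c • f) := fun I J => by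
  have := mul_le_mul_of_nonneg_left (hf I J) hc
  simp only [Pi.smul_apply, smul_eq_mul]
  linarith

lemma supermodular_zero : Supermodular (0 : Finset (Fin d) → ℝ) := fun I J => by simp

lemma Supermodular.sum {ι : Type*} {s : Finset ι} {f : ι → Finset (Fin d) → ℝ}
    (hf : ∀ i ∈ s, Supermodular (f i)) : Supermodular (∑ i ∈ s, f i) :=
  Finset.sum_induction f Supermodular (fun _ _ => Supermodular.add) supermodular_zero hf

/-- The set function `J ↦ |J| (|J| + 1) / 2`, whose second differences are all `1`. -/
noncomputable def triangular (d : ℕ) (J : Finset (Fin d)) : ℝ := (J.card : ℝ) * (J.card + 1) / 2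

lemma triangular_insert {A : Finset (Fin d)} {i : Fin d} (hi : i ∉ A) :
    triangular d (insert i A) = triangular d A + A.card + 1 := by
  simp only [triangular, Finset.card_insert_of_notMem hi]
  push_cast
  ring

lemma triangular_insert_insert {A : Finset (Fin d)} {i j : Fin d} (hi : i ∉ A) (hj : j ∉ A)
    (hij : i ≠ j) :
    triangular d (insert i (insert j A)) + triangular d A =
      triangular d (insert i A) + triangular d (insert j A) + 1 := by
  rw [triangular_insert (by simp [hij, hi] : i ∉ insert j A), triangular_insert hi,
    triangular_insert hj, Finset.card_insert_of_notMem hj]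
  push_cast
  ring

lemma supermodular_triangular : Supermodular (triangular d) :=
  supermodular_of_insert fun A i j hi hj hij => by
    have := triangular_insert_insert hi hj hij
    linarith

lemma triangular_empty : triangular d ∅ = 0 := by simp [triangular]

end GenPerm

/-! ### Base polytopes and the greedy algorithm -/

namespace GenPerm

variable {d : ℕ}

/-- The base polytope of the set function `f`: the points `x` with `x([d]) = f([d])` and
`x(J) ≥ f(J)` for all `J`, where `x(J) = ∑_{i ∈ J} x_i`. -/
def basePolytope (f : Finset (Fin d) → ℝ) : Set (Fin d → ℝ) :=
  {x | ∑ i, x i = f Finset.univ ∧ ∀ J : Finset (Fin d), f J ≤ ∑ i ∈ J, x i}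

/-- The `k` elements that come first in the order `σ`. -/
def initialSegment (σ : Equiv.Perm (Fin d)) (k : ℕ) : Finset (Fin d) :=
  Finset.univ.filter fun i => (σ i : ℕ) < k

/-- The greedy point of `f` for the order `σ`: its coordinates are the increments of `f` along
the chain of initial segments of `σ`. -/
def greedy (f : Finset (Fin d) → ℝ) (σ : Equiv.Perm (Fin d)) (i : Fin d) : ℝ :=
  f (initialSegment σ (σ i + 1)) - f (initialSegment σ (σ i))

lemma mem_initialSegment {σ : Equiv.Perm (Fin d)} {k : ℕ} {i : Fin d} :
    i ∈ initialSegment σ k ↔ (σ i : ℕ) < k := by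
  simp [initialSegment]

lemma initialSegment_zero (σ : Equiv.Perm (Fin d)) : initialSegment σ 0 = ∅ := by
  ext i; simp [mem_initialSegment]

lemma initialSegment_self (σ : Equiv.Perm (Fin d)) : initialSegment σ d = Finset.univ := by
  ext i; simp [mem_initialSegment]

lemma initialSegment_succ (σ : Equiv.Perm (Fin d)) (i : Fin d) :
    initialSegment σ (σ i + 1) = insert i (initialSegment σ (σ i)) := by
  ext j
  rw [Finset.mem_insert, mem_initialSegment, mem_initialSegment, Order.lt_add_one_iff,
    le_iff_eq_or_lt, Fin.val_inj, σ.injective.eq_iff]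

lemma notMem_initialSegment (σ : Equiv.Perm (Fin d)) (i : Fin d) :
    i ∉ initialSegment σ (σ i) := by simp [mem_initialSegment]

/-- Induction along the chain of initial segments, adding one element at a time. -/
lemma initialSegment_induction (σ : Equiv.Perm (Fin d)) {p : Finset (Fin d) → Prop} (h0 : p ∅)
    (hs : ∀ i, p (initialSegment σ (σ i)) → p (insert i (initialSegment σ (σ i)))) :
    ∀ k ≤ d, p (initialSegment σ k) := by
  intro k
  induction k with
  | zero => intro _; rwa [initialSegment_zero]
  | succ k ih =>
    intro hk
    have hσ : ((σ (σ.symm ⟨k, hk⟩) : Fin d) : ℕ) = k := by simp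
    have h := hs (σ.symm ⟨k, hk⟩)
    rw [← initialSegment_succ, hσ] at h
    exact h (ih (Nat.le_of_succ_le hk))

lemma card_initialSegment (σ : Equiv.Perm (Fin d)) {k : ℕ} (hk : k ≤ d) :
    (initialSegment σ k).card = k := by
  induction k with
  | zero => simp [initialSegment_zero]
  | succ k ih =>
    have hσ : ((σ (σ.symm ⟨k, hk⟩) : Fin d) : ℕ) = k := by simp
    have h := initialSegment_succ σ (σ.symm ⟨k, hk⟩)
    have h' := notMem_initialSegment σ (σ.symm ⟨k, hk⟩)
    rw [hσ] at h h'
    rw [h, Finset.card_insert_of_notMem h', ih (Nat.le_of_succ_le hk)]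

lemma sum_greedy_initialSegment {f : Finset (Fin d) → ℝ} (h0 : f ∅ = 0)
    (σ : Equiv.Perm (Fin d)) {k : ℕ} (hk : k ≤ d) :
    ∑ i ∈ initialSegment σ k, greedy f σ i = f (initialSegment σ k) := by
  refine initialSegment_induction σ (p := fun S => ∑ i ∈ S, greedy f σ i = f S) (by simp [h0])
    (fun i ih => ?_) k hk
  rw [Finset.sum_insert (notMem_initialSegment σ i), ih, greedy, initialSegment_succ]
  ring

lemma sum_greedy {f : Finset (Fin d) → ℝ} (h0 : f ∅ = 0) (σ : Equiv.Perm (Fin d)) :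
    ∑ i, greedy f σ i = f Finset.univ := by
  have := sum_greedy_initialSegment h0 σ le_rfl
  rwa [initialSegment_self] at this

lemma greedy_mem {f : Finset (Fin d) → ℝ} (hf : Supermodular f) (h0 : f ∅ = 0)
    (σ : Equiv.Perm (Fin d)) : greedy f σ ∈ basePolytope f := by
  refine ⟨sum_greedy h0 σ, fun J => ?_⟩
  have h := initialSegment_induction σ
    (p := fun S => f (J ∩ S) ≤ ∑ i ∈ J ∩ S, greedy f σ i) (by simp [h0])
    (fun i ih => ?_) d le_rfl
  · simpa [initialSegment_self] using h
  · by_cases hi : i ∈ J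
    · rw [Finset.inter_insert_of_mem hi, Finset.sum_insert
        (fun h => notMem_initialSegment σ i (Finset.mem_inter.1 h).2), greedy,
        initialSegment_succ]
      have h := hf (insert i (J ∩ initialSegment σ (σ i))) (initialSegment σ (σ i))
      have e1 : insert i (J ∩ initialSegment σ (σ i)) ∪ initialSegment σ (σ i) =
          insert i (initialSegment σ (σ i)) := by ext x; simp; tauto
      have e2 : insert i (J ∩ initialSegment σ (σ i)) ∩ initialSegment σ (σ i) =
          J ∩ initialSegment σ (σ i) := by
        rw [Finset.insert_inter_of_notMem (notMem_initialSegment σ i), Finset.inter_assoc,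
          Finset.inter_self]
      rw [e1, e2] at h
      linarith
    · rwa [Finset.inter_insert_of_notMem hi]

/-- If `σ` lists the coordinates in decreasing order of `w`, then the greedy point for `σ`
minimizes `w` on the base polytope. This is summation by parts, arranged as an induction. -/
lemma sum_mul_greedy_le {f : Finset (Fin d) → ℝ} (h0 : f ∅ = 0) {σ : Equiv.Perm (Fin d)}
    {w : Fin d → ℝ} (hw : ∀ i j, σ i < σ j → w j ≤ w i) {x : Fin d → ℝ}
    (hx : x ∈ basePolytope f) : ∑ i, w i * greedy f σ i ≤ ∑ i, w i * x i := by
  let u : Fin d → ℝ := fun i => x i - greedy f σ i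
  have hu : ∀ k ≤ d, 0 ≤ ∑ i ∈ initialSegment σ k, u i := fun k hk => by
    have h1 := hx.2 (initialSegment σ k)
    rw [← sum_greedy_initialSegment h0 σ hk] at h1
    simp only [u, Finset.sum_sub_distrib]
    linarith
  have key := initialSegment_induction σ
    (p := fun S => ∀ c, (∀ j ∈ S, c ≤ w j) → c * ∑ i ∈ S, u i ≤ ∑ i ∈ S, w i * u i) (by simp)
    (fun i ih c hc => ?_) d le_rfl
  · obtain ⟨c, hc⟩ := (Set.finite_range w).bddBelow
    have h := key c fun j _ => hc ⟨j, rfl⟩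
    rw [initialSegment_self] at h
    have hsum : ∑ i, u i = 0 := by
      simp only [u, Finset.sum_sub_distrib, sum_greedy h0, hx.1, sub_self]
    simp only [hsum, mul_zero, u, mul_sub, Finset.sum_sub_distrib] at h
    linarith
  · have h1 := ih (w i) fun j hj => hw _ _ (by rwa [mem_initialSegment] at hj)
    have h2 := hu (σ i + 1) (σ i).2
    rw [initialSegment_succ] at h2
    have h3 := mul_le_mul_of_nonneg_right (hc i (Finset.mem_insert_self _ _)) h2
    rw [Finset.sum_insert (notMem_initialSegment σ i)] at h2 h3 ⊢
    rw [Finset.sum_insert (notMem_initialSegment σ i)]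
    linarith

lemma exists_perm_antitone (w : Fin d → ℝ) :
    ∃ σ : Equiv.Perm (Fin d), ∀ i j, σ i < σ j → w j ≤ w i := by
  refine ⟨(Tuple.sort fun i => -w i).symm, fun i j hij => ?_⟩
  have h := Tuple.monotone_sort (fun i => -w i) hij.le
  simpa using h

lemma convex_basePolytope (f : Finset (Fin d) → ℝ) : Convex ℝ (basePolytope f) := by
  intro x hx y hy a b ha hb hab
  have hsum : ∀ J : Finset (Fin d), ∑ i ∈ J, (a • x + b • y) i =
      a * ∑ i ∈ J, x i + b * ∑ i ∈ J, y i := fun J => by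
    simp [Finset.sum_add_distrib, Finset.mul_sum]
  refine ⟨?_, fun J => ?_⟩
  · rw [hsum, hx.1, hy.1, ← add_mul, hab, one_mul]
  · rw [hsum]
    have h1 := mul_le_mul_of_nonneg_left (hx.2 J) ha
    have h2 := mul_le_mul_of_nonneg_left (hy.2 J) hb
    have h3 : f J = a * f J + b * f J := by rw [← add_mul, hab, one_mul]
    linarith

/-- A base polytope is the convex hull of its greedy points: by the greedy algorithm no
hyperplane separates another point of it from all of them. -/
lemma basePolytope_eq_convexHull {f : Finset (Fin d) → ℝ} (hf : Supermodular f) (h0 : f ∅ = 0) :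
    basePolytope f = convexHull ℝ (Set.range (greedy f)) := by
  apply Set.Subset.antisymm
  · intro x hx
    by_contra hcon
    obtain ⟨l, u, hlx, hlu⟩ := geometric_hahn_banach_point_closed (convex_convexHull ℝ _)
      ((Set.finite_range (greedy f)).isClosed_convexHull ℝ) hcon
    let w : Fin d → ℝ := fun i => l (Pi.single i 1)
    have hl : ∀ v : Fin d → ℝ, l v = ∑ i, w i * v i := fun v => by
      conv_lhs => rw [pi_eq_sum_univ' v]
      simp [w, mul_comm]
    obtain ⟨σ, hσ⟩ := exists_perm_antitone w
    have h1 := sum_mul_greedy_le h0 hσ hx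
    have h2 := hlu (greedy f σ) (subset_convexHull ℝ _ ⟨σ, rfl⟩)
    rw [← hl, ← hl] at h1
    linarith
  · refine convexHull_min ?_ (convex_basePolytope f)
    rintro _ ⟨σ, rfl⟩
    exact greedy_mem hf h0 σ

lemma isPolytope_basePolytope {f : Finset (Fin d) → ℝ} (hf : Supermodular f) (h0 : f ∅ = 0) :
    IsPolytope (basePolytope f) :=
  ⟨(Set.finite_range (greedy f)).toFinset, by
    rw [basePolytope_eq_convexHull hf h0, Set.Finite.coe_toFinset]⟩

lemma basePolytope_add {f g : Finset (Fin d) → ℝ} (hf : Supermodular f) (hf0 : f ∅ = 0)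
    (hg : Supermodular g) (hg0 : g ∅ = 0) :
    basePolytope f + basePolytope g = basePolytope (f + g) := by
  apply Set.Subset.antisymm
  · rintro _ ⟨x, hx, y, hy, rfl⟩
    refine ⟨?_, fun J => ?_⟩
    · simp [Finset.sum_add_distrib, hx.1, hy.1]
    · simp only [Pi.add_apply, Finset.sum_add_distrib]
      exact add_le_add (hx.2 J) (hy.2 J)
  · rw [basePolytope_eq_convexHull (hf.add hg) (by simp [hf0, hg0])]
    refine convexHull_min ?_ ((convex_basePolytope f).add (convex_basePolytope g))
    rintro _ ⟨σ, rfl⟩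
    refine ⟨_, greedy_mem hf hf0 σ, _, greedy_mem hg hg0 σ, ?_⟩
    funext i
    simp only [greedy, Pi.add_apply]
    ring

lemma smul_basePolytope {f : Finset (Fin d) → ℝ} (hf : Supermodular f) (h0 : f ∅ = 0) {c : ℝ}
    (hc : 0 ≤ c) : c • basePolytope f = basePolytope (c • f) := by
  rw [basePolytope_eq_convexHull hf h0,
    basePolytope_eq_convexHull (hf.smul hc) (by simp [h0]), ← convexHull_smul, Set.smul_set_range]
  congr 2
  funext σ i
  simp [greedy, mul_sub]

lemma basePolytope_zero : basePolytope (0 : Finset (Fin d) → ℝ) = {0} := by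
  rw [basePolytope_eq_convexHull supermodular_zero rfl]
  have : greedy (0 : Finset (Fin d) → ℝ) = fun _ => 0 := by
    funext σ i; simp [greedy]
  rw [this, Set.range_const, convexHull_singleton]

lemma sum_basePolytope {ι : Type*} {s : Finset ι} {f : ι → Finset (Fin d) → ℝ}
    (hf : ∀ i ∈ s, Supermodular (f i)) (h0 : ∀ i ∈ s, f i ∅ = 0) :
    ∑ i ∈ s, basePolytope (f i) = basePolytope (∑ i ∈ s, f i) := by
  classical
  induction s using Finset.induction_on with
  | empty => simp [basePolytope_zero]; rfl
  | insert a s ha ih =>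
    have hf' : ∀ i ∈ s, Supermodular (f i) := fun i hi => hf i (Finset.mem_insert_of_mem hi)
    have h0' : ∀ i ∈ s, f i ∅ = 0 := fun i hi => h0 i (Finset.mem_insert_of_mem hi)
    rw [Finset.sum_insert ha, Finset.sum_insert ha, ih hf' h0',
      basePolytope_add (hf a (Finset.mem_insert_self _ _)) (h0 a (Finset.mem_insert_self _ _))
        (Supermodular.sum hf') (by rw [Finset.sum_apply]; exact Finset.sum_eq_zero h0')]

/-- Two nested subsets are both initial segments of a common order. -/
lemma exists_initialSegment {I J : Finset (Fin d)} (hIJ : I ⊆ J) :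
    ∃ σ : Equiv.Perm (Fin d), (∃ k ≤ d, I = initialSegment σ k) ∧
      ∃ k ≤ d, J = initialSegment σ k := by
  obtain ⟨σ, hσ⟩ := exists_perm_antitone fun i =>
    (if i ∈ I then (1 : ℝ) else 0) + if i ∈ J then 1 else 0
  -- a subset that is closed under predecessors is an initial segment
  have h : ∀ K : Finset (Fin d), (∀ i j, j ∈ K → i ∉ K → σ j < σ i) →
      ∃ k ≤ d, K = initialSegment σ k := by
    intro K hK
    refine ⟨K.sup fun i => (σ i : ℕ) + 1, Finset.sup_le fun i _ => (σ i).2, ?_⟩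
    ext i
    rw [mem_initialSegment, Finset.lt_sup_iff]
    constructor
    · exact fun hi => ⟨i, hi, Nat.lt_succ_self _⟩
    · rintro ⟨j, hj, hij⟩
      by_contra hi
      have := hK i j hj hi
      rw [Fin.lt_def] at this
      omega
  have hlt : ∀ i j : Fin d, (if i ∈ I then (1 : ℝ) else 0) + (if i ∈ J then 1 else 0) <
      (if j ∈ I then (1 : ℝ) else 0) + (if j ∈ J then 1 else 0) → σ j < σ i := by
    intro i j hij
    by_contra hcon
    rcases lt_or_eq_of_le (not_lt.1 hcon) with h | h
    · exact absurd (hσ i j h) (not_le.2 hij)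
    · rw [σ.injective h] at hij
      exact lt_irrefl _ hij
  refine ⟨σ, h I fun i j hj hi => hlt i j ?_, h J fun i j hj hi => hlt i j ?_⟩
  · rw [if_neg hi, if_pos hj, if_pos (hIJ hj)]
    split_ifs <;> norm_num
  · rw [if_neg hi, if_pos hj, if_neg fun h => hi (hIJ h)]
    split_ifs <;> norm_num

/-- For nested `I ⊆ J` a base polytope has a point at which the inequalities of both `I` and `J`
are tight. -/
lemma exists_mem_basePolytope_tight {f : Finset (Fin d) → ℝ} (hf : Supermodular f) (h0 : f ∅ = 0)
    {I J : Finset (Fin d)} (hIJ : I ⊆ J) :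
    ∃ x ∈ basePolytope f, ∑ i ∈ I, x i = f I ∧ ∑ i ∈ J, x i = f J := by
  obtain ⟨σ, ⟨k, hk, rfl⟩, l, hl, rfl⟩ := exists_initialSegment hIJ
  exact ⟨greedy f σ, greedy_mem hf h0 σ, sum_greedy_initialSegment h0 σ hk,
    sum_greedy_initialSegment h0 σ hl⟩

/-! ### Simplices and the permutahedron as base polytopes -/

lemma permutahedron_eq_basePolytope (d : ℕ) : permutahedron d = basePolytope (triangular d) := by
  rw [basePolytope_eq_convexHull supermodular_triangular triangular_empty, permutahedron]
  congr 2
  funext σ i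
  rw [greedy, initialSegment_succ, triangular_insert (notMem_initialSegment σ i),
    card_initialSegment σ (σ i).2.le]
  ring

/-- The set function with base polytope `Δ_I`: the indicator of `I ⊆ J` for `I ≠ ∅`, and `0` for
`I = ∅`. -/
noncomputable def simplexFunction (I J : Finset (Fin d)) : ℝ := if I.Nonempty ∧ I ⊆ J then 1 else 0

lemma simplexFunction_empty_right (I : Finset (Fin d)) : simplexFunction I ∅ = 0 :=
  if_neg fun h => h.1.ne_empty (Finset.subset_empty.1 h.2)

lemma supermodular_simplexFunction (I : Finset (Fin d)) : Supermodular (simplexFunction I) := by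
  intro J K
  by_cases hI : I.Nonempty
  · simp only [simplexFunction, hI, true_and, Finset.subset_inter_iff]
    by_cases hJ : I ⊆ J <;> by_cases hK : I ⊆ K
    · have := hJ.trans (Finset.subset_union_left (s₂ := K)); simp [*]
    · have := hJ.trans (Finset.subset_union_left (s₂ := K)); simp [*]
    · have := hK.trans (Finset.subset_union_right (s₁ := J)); simp [*]
    · simp only [hJ, hK, and_self, if_false, add_zero]
      split_ifs <;> norm_num
  · simp [simplexFunction, hI]

lemma simplex_eq_basePolytope (I : Finset (Fin d)) :
    simplex I = basePolytope (simplexFunction I) := by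
  rcases Finset.eq_empty_or_nonempty I with rfl | hI
  · have : simplexFunction (∅ : Finset (Fin d)) = 0 := by
      funext J; simp [simplexFunction]
    rw [this, basePolytope_zero, simplex, if_pos rfl]
  · rw [simplex, if_neg hI.ne_empty]
    apply Set.Subset.antisymm
    · refine convexHull_min ?_ (convex_basePolytope _)
      rintro _ ⟨i, hi, rfl⟩
      refine ⟨by simp [simplexFunction, hI], fun J => ?_⟩
      have hsum : ∑ j ∈ J, (Pi.single i 1 : Fin d → ℝ) j = if i ∈ J then 1 else 0 := by
        simp [Pi.single_apply]
      refine le_of_le_of_eq ?_ hsum.symm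
      rw [simplexFunction]
      by_cases hJ : i ∈ J
      · rw [if_pos hJ]; split_ifs <;> norm_num
      · rw [if_neg hJ, if_neg fun h => hJ (h.2 hi)]
    · intro x hx
      have hx0 : ∀ i, 0 ≤ x i := fun i => by
        have h := hx.2 {i}
        rw [Finset.sum_singleton] at h
        refine le_trans ?_ h
        rw [simplexFunction]; split_ifs <;> norm_num
      have htot : ∑ i, x i = 1 := by rw [hx.1]; simp [simplexFunction, hI]
      have hxI : ∑ i ∈ I, x i = 1 := by
        apply le_antisymm
        · rw [← htot]
          exact Finset.sum_le_sum_of_subset_of_nonneg (Finset.subset_univ _) fun i _ _ => hx0 i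
        · have h := hx.2 I
          rwa [simplexFunction, if_pos ⟨hI, subset_rfl⟩] at h
      have hout : ∀ i, i ∉ I → x i = 0 := fun i hi => by
        have h := Finset.sum_le_sum_of_subset_of_nonneg (Finset.subset_univ (insert i I))
          (fun j _ _ => hx0 j)
        rw [Finset.sum_insert hi, hxI, htot] at h
        linarith [hx0 i]
      have hxe : x = ∑ i ∈ I, x i • (Pi.single i 1 : Fin d → ℝ) := by
        funext j
        rw [Finset.sum_apply]
        by_cases hj : j ∈ I
        · simp [Pi.single_apply, hj]
        · simp [Pi.single_apply, hj, hout j hj]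
      rw [hxe]
      exact (convex_convexHull ℝ _).sum_mem (fun i _ => hx0 i) hxI fun i hi =>
        subset_convexHull ℝ _ ⟨i, hi, rfl⟩

lemma sum_smul_simplex {s : Finset (Finset (Fin d))} {c : Finset (Fin d) → ℝ}
    (hc : ∀ I ∈ s, 0 ≤ c I) :
    ∑ I ∈ s, c I • simplex I = basePolytope (∑ I ∈ s, c I • simplexFunction I) := by
  rw [← sum_basePolytope
    (fun I hI => (supermodular_simplexFunction I).smul (hc I hI))
    (fun I _ => by simp [simplexFunction_empty_right])]
  refine Finset.sum_congr rfl fun I hI => ?_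
  rw [simplex_eq_basePolytope, smul_basePolytope (supermodular_simplexFunction I)
    (simplexFunction_empty_right I) (hc I hI)]

end GenPerm

/-! ### Facets of a cone given by irredundant inequalities -/

namespace GenPerm

section Facets

variable {V ι : Type*} [AddCommGroup V] [Module ℝ V]
  {C : PointedCone ℝ V} {φ : ι → Module.Dual ℝ V}

/-- A point at which finitely many linear forms are positive can absorb any direction: after
subtracting a small positive multiple of `y` they are still positive. -/
lemma exists_pos_sub_smul [Finite ι] (ψ : ι → Module.Dual ℝ V) {x : V} (hx : ∀ i, 0 < ψ i x) (y : V) :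
    ∃ ε : ℝ, 0 < ε ∧ ∀ i, 0 < ψ i (x - ε • y) := by
  have h : ∀ᶠ ε in nhdsWithin (0 : ℝ) (Set.Ioi 0), ∀ i, 0 < ψ i (x - ε • y) := by
    rw [Filter.eventually_all]
    intro i
    have hc : Filter.Tendsto (fun ε : ℝ => ψ i x - ε * ψ i y) (nhdsWithin 0 (Set.Ioi 0))
        (nhds (ψ i x - 0 * ψ i y)) :=
      (Continuous.tendsto (by fun_prop) 0).mono_left nhdsWithin_le_nhds
    have := hc.eventually (lt_mem_nhds (show 0 < ψ i x - 0 * ψ i y by simpa using hx i))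
    filter_upwards [this] with ε hε
    simpa using hε
  obtain ⟨ε, h1, h2⟩ := (h.and self_mem_nhdsWithin).exists
  exact ⟨ε, h2, h1⟩

lemma span_eq_top_of_pos [Finite ι] (hC : ∀ x, x ∈ C ↔ ∀ i, 0 ≤ φ i x) {x₀ : V} (hx₀ : ∀ i, 0 < φ i x₀) :
    Submodule.span ℝ (C : Set V) = ⊤ := by
  rw [eq_top_iff]
  intro y _
  obtain ⟨ε, hε, h⟩ := exists_pos_sub_smul φ hx₀ y
  have h1 : x₀ ∈ Submodule.span ℝ (C : Set V) :=
    Submodule.subset_span ((hC _).2 fun i => (hx₀ i).le)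
  have h2 : x₀ - ε • y ∈ Submodule.span ℝ (C : Set V) :=
    Submodule.subset_span ((hC _).2 fun i => (h i).le)
  have h3 := Submodule.sub_mem _ h1 h2
  rw [sub_sub_cancel] at h3
  exact (Submodule.smul_mem_iff _ hε.ne').1 h3

/-- The points of the cone `C` at which the linear form `ψ` vanishes. -/
def zeroFace (C : PointedCone ℝ V) (ψ : Module.Dual ℝ V) : PointedCone ℝ V where
  carrier := {x | x ∈ C ∧ ψ x = 0}
  zero_mem' := ⟨C.zero_mem, map_zero _⟩
  add_mem' := fun ha hb => ⟨C.add_mem ha.1 hb.1, by rw [map_add, ha.2, hb.2, add_zero]⟩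
  smul_mem' := fun c x hx => ⟨C.smul_mem c.2 hx.1, by
    change ψ ((c : ℝ) • x) = 0
    rw [map_smul, hx.2, smul_zero]⟩

lemma mem_zeroFace {ψ : Module.Dual ℝ V} {x : V} : x ∈ zeroFace C ψ ↔ x ∈ C ∧ ψ x = 0 := Iff.rfl

lemma span_zeroFace [Finite ι] (hC : ∀ x, x ∈ C ↔ ∀ i, 0 ≤ φ i x) {i : ι} {x : V} (hxi : φ i x = 0)
    (hx : ∀ j, j ≠ i → 0 < φ j x) :
    Submodule.span ℝ (zeroFace C (φ i) : Set V) = LinearMap.ker (φ i) := by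
  apply le_antisymm
  · rw [Submodule.span_le]
    exact fun y hy => hy.2
  · intro y hy
    rw [LinearMap.mem_ker] at hy
    obtain ⟨ε, hε, h⟩ := exists_pos_sub_smul (fun j : {j // j ≠ i} => φ j) (fun j => hx j j.2) y
    have hmem : ∀ v : V, φ i v = 0 → (∀ j, j ≠ i → 0 < φ j v) → v ∈ zeroFace C (φ i) :=
      fun v h0 h1 => ⟨(hC v).2 fun j => by
        by_cases hj : j = i
        · rw [hj, h0]
        · exact (h1 j hj).le, h0⟩
    have h1 := Submodule.subset_span (R := ℝ) (hmem x hxi hx)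
    have h2 := Submodule.subset_span (R := ℝ)
      (hmem (x - ε • y) (by simp [hxi, hy]) fun j hj => h ⟨j, hj⟩)
    have h3 := Submodule.sub_mem _ h1 h2
    rw [sub_sub_cancel] at h3
    exact (Submodule.smul_mem_iff _ hε.ne').1 h3

lemma isFacetOf_zeroFace [FiniteDimensional ℝ V] [Finite ι] (hC : ∀ x, x ∈ C ↔ ∀ i, 0 ≤ φ i x) {x₀ : V} (hx₀ : ∀ i, 0 < φ i x₀)
    {i : ι} {x : V} (hxi : φ i x = 0) (hx : ∀ j, j ≠ i → 0 < φ j x) :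
    IsFacetOf (zeroFace C (φ i)) C := by
  refine ⟨⟨fun y hy => hy.1, fun {u v a} hu hv ha huv => ⟨hu, ?_⟩⟩, ?_⟩
  · have h1 := huv.2
    have h2 := (hC u).1 hu i
    have h3 := (hC v).1 hv i
    rw [map_add, map_smul, smul_eq_mul] at h1
    have h4 : a * φ i u ≤ a * 0 := by linarith
    exact le_antisymm (le_of_mul_le_mul_left h4 ha) h2
  · rw [span_zeroFace hC hxi hx, span_eq_top_of_pos hC hx₀, finrank_top]
    exact Module.Dual.finrank_ker_add_one_of_ne_zero fun h => (hx₀ i).ne' (by simp [h])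

/-- A facet `F` contains no point at which all forms are positive, since such a point absorbs
all of `C` into `F`; as `F` is closed under addition, one of the forms vanishes on it. -/
lemma IsFacetOf.exists_forall_eq_zero [Finite ι] (hC : ∀ x, x ∈ C ↔ ∀ i, 0 ≤ φ i x)
    {F : PointedCone ℝ V} (hF : IsFacetOf F C) : ∃ i, ∀ x ∈ F, φ i x = 0 := by
  cases nonempty_fintype ι
  by_contra! hcon
  choose p hpF hp using hcon
  have hpos : ∀ i, 0 < φ i (p i) := fun i =>
    lt_of_le_of_ne ((hC _).1 (hF.1.le (hpF i)) i) (hp i).symm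
  have hsumF : ∑ j, p j ∈ F := Submodule.sum_mem _ fun j _ => hpF j
  have hsum : ∀ i, 0 < φ i (∑ j, p j) := fun i => by
    rw [map_sum]
    exact Finset.sum_pos' (fun j _ => (hC _).1 (hF.1.le (hpF j)) i) ⟨i, Finset.mem_univ i, hpos i⟩
  have hCF : F = C := by
    refine le_antisymm hF.1.le fun c hc => ?_
    obtain ⟨ε, hε, h⟩ := exists_pos_sub_smul φ hsum c
    refine hF.1.mem_of_smul_add_mem hc ((hC _).2 fun i => (h i).le) hε ?_
    rwa [add_sub_cancel]
  have := hF.2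
  rw [hCF] at this
  omega

lemma IsFacetOf.exists_eq_zeroFace [FiniteDimensional ℝ V] [Finite ι] (hC : ∀ x, x ∈ C ↔ ∀ i, 0 ≤ φ i x) {x₀ : V}
    (hx₀ : ∀ i, 0 < φ i x₀) {F : PointedCone ℝ V} (hF : IsFacetOf F C) :
    ∃ i, F = zeroFace C (φ i) := by
  obtain ⟨i, hi⟩ := hF.exists_forall_eq_zero hC
  refine ⟨i, le_antisymm (fun x hx => ⟨hF.1.le hx, hi x hx⟩) fun c hc => ?_⟩
  have hle : Submodule.span ℝ (F : Set V) ≤ LinearMap.ker (φ i) :=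
    Submodule.span_le.2 fun x hx => hi x hx
  have hspan : Submodule.span ℝ (F : Set V) = LinearMap.ker (φ i) := by
    apply Submodule.eq_of_le_of_finrank_eq hle
    have h1 := hF.2
    rw [span_eq_top_of_pos hC hx₀, finrank_top] at h1
    have h2 := Module.Dual.finrank_ker_add_one_of_ne_zero (f := φ i)
      fun h => (hx₀ i).ne' (by simp [h])
    omega
  -- every element of the span of a cone is a difference of two elements of the cone
  have hdiff : ∀ x ∈ Submodule.span ℝ (F : Set V), ∃ a ∈ F, ∃ b ∈ F, x + b = a := by
    intro x hx
    induction hx using Submodule.span_induction with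
    | mem x hx => exact ⟨x, hx, 0, F.zero_mem, add_zero x⟩
    | zero => exact ⟨0, F.zero_mem, 0, F.zero_mem, add_zero 0⟩
    | add x y _ _ hx hy =>
      obtain ⟨a, ha, b, hb, rfl⟩ := hx
      obtain ⟨a', ha', b', hb', rfl⟩ := hy
      exact ⟨_, F.add_mem ha ha', b + b', F.add_mem hb hb', by abel⟩
    | smul t x _ hx =>
      obtain ⟨a, ha, b, hb, rfl⟩ := hx
      rcases le_total 0 t with ht | ht
      · exact ⟨_, F.smul_mem ht ha, _, F.smul_mem ht hb, (smul_add t x b).symm⟩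
      · refine ⟨_, F.smul_mem (neg_nonneg.2 ht) hb, _,
          F.smul_mem (neg_nonneg.2 ht) ha, ?_⟩
        change t • x + (-t) • (x + b) = (-t) • b
        module
  obtain ⟨a, ha, b, hb, hab⟩ := hdiff c (hspan ▸ hc.2)
  refine hF.1.mem_of_smul_add_mem hc.1 (hF.1.le hb) one_pos ?_
  rwa [one_smul, hab]

lemma zeroFace_injective (hC : ∀ x, x ∈ C ↔ ∀ i, 0 ≤ φ i x)
    {x : ι → V} (hxi : ∀ i, φ i (x i) = 0) (hx : ∀ i j, j ≠ i → 0 < φ j (x i)) :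
    Function.Injective fun i => zeroFace C (φ i) := by
  intro i j hij
  by_contra hne
  have hmem : x i ∈ zeroFace C (φ i) := ⟨(hC _).2 fun k => by
    by_cases hk : k = i
    · rw [hk, hxi]
    · exact (hx i k hk).le, hxi i⟩
  have hij : zeroFace C (φ i) = zeroFace C (φ j) := hij
  rw [hij] at hmem
  exact (hx i j (Ne.symm hne)).ne' hmem.2

lemma isPolyhedral_of_mem_iff [Finite ι] (hC : ∀ x, x ∈ C ↔ ∀ i, 0 ≤ φ i x) : IsPolyhedral C := by
  refine ⟨(Set.finite_range φ).toFinset, ?_⟩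
  ext x
  rw [PointedCone.mem_dual, hC]
  simp

end Facets

end GenPerm

/-! ### Signed Minkowski sums of simplices -/

namespace GenPerm

variable {d : ℕ}

/-- Both sides of the equation that defines a signed Minkowski sum are base polytopes. -/
lemma signedSumDefines_iff (y : Finset (Fin d) → ℝ) (R : Set (Fin d → ℝ)) :
    SignedSumDefines y R ↔ IsPolytope R ∧
      R + basePolytope (∑ I with y I < 0, (-y I) • simplexFunction I) =
        basePolytope (∑ I with 0 ≤ y I, y I • simplexFunction I) := by
  rw [SignedSumDefines, sum_smul_simplex, sum_smul_simplex]
  · exact fun I hI => (Finset.mem_filter.1 hI).2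
  · exact fun I hI => (neg_pos.2 (Finset.mem_filter.1 hI).2).le

/-- The set functions of the two sides differ by `zeta y - zeta y ∅`; the coefficient `y ∅` drops
out because `Δ_∅ = {0}`. -/
lemma sum_pos_sub_sum_neg (y : Finset (Fin d) → ℝ) (J : Finset (Fin d)) :
    (∑ I with 0 ≤ y I, y I • simplexFunction I) J -
      (∑ I with y I < 0, (-y I) • simplexFunction I) J = zeta y J - zeta y ∅ := by
  have h1 : ∑ I, y I * simplexFunction I J = zeta y J - zeta y ∅ := by
    have h2 : zeta y J = ∑ I, y I * (if I ⊆ J then 1 else 0) := by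
      simp [zeta, ← Finset.sum_filter, ← Finset.filter_subset_univ]
    have h3 : zeta y ∅ = ∑ I, y I * (if I = ∅ then 1 else 0) := by simp [zeta]
    rw [h2, h3, ← Finset.sum_sub_distrib]
    refine Finset.sum_congr rfl fun I _ => ?_
    rcases Finset.eq_empty_or_nonempty I with rfl | hI
    · simp [simplexFunction]
    · simp [simplexFunction, hI, hI.ne_empty]
  rw [← h1, ← Finset.sum_filter_add_sum_filter_not Finset.univ (fun I => 0 ≤ y I)]
  simp only [not_le, Finset.sum_apply, Pi.smul_apply, smul_eq_mul, neg_mul,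
    Finset.sum_neg_distrib]
  ring

lemma supermodular_sum_smul_simplexFunction {s : Finset (Finset (Fin d))}
    {c : Finset (Fin d) → ℝ} (hc : ∀ I ∈ s, 0 ≤ c I) :
    Supermodular (∑ I ∈ s, c I • simplexFunction I) :=
  Supermodular.sum fun I hI => (supermodular_simplexFunction I).smul (hc I hI)

lemma sum_smul_simplexFunction_empty (s : Finset (Finset (Fin d))) (c : Finset (Fin d) → ℝ) :
    (∑ I ∈ s, c I • simplexFunction I) ∅ = 0 := by
  simp [Finset.sum_apply, simplexFunction_empty_right]

/-- If `zeta y` is supermodular, the signed sum defines the base polytope of `zeta y - zeta y ∅`,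
which is a summand of `l Π_d` as soon as `l` bounds the second differences of `zeta y`. -/
lemma definesGeneralizedPermutahedron_of_supermodular {y : Finset (Fin d) → ℝ}
    (hy : Supermodular (zeta y)) : DefinesGeneralizedPermutahedron y := by
  set f : Finset (Fin d) → ℝ := fun J => zeta y J - zeta y ∅ with hf_def
  have hf : Supermodular f := fun I J => by
    have := hy I J
    simp only [hf_def]
    linarith
  have hf0 : f ∅ = 0 := sub_self _
  have hneg : ∀ I ∈ Finset.univ.filter (fun I => y I < 0), 0 ≤ -y I :=
    fun I hI => (neg_pos.2 (Finset.mem_filter.1 hI).2).le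
  set l : ℝ := 1 + ∑ I, |y I| with hl_def
  have hl : 0 < l := by positivity
  have hg : Supermodular (l • triangular d - f) := by
    refine supermodular_of_insert fun A i j hi hj hij => ?_
    have h1 := triangular_insert_insert hi hj hij
    have h2 := sum_Icc_insert y hi hj hij
    have h3 : ∑ I ∈ Finset.Icc {i, j} (insert i (insert j A)), y I ≤ ∑ I, |y I| :=
      (Finset.sum_le_sum fun I _ => le_abs_self (y I)).trans
        (Finset.sum_le_sum_of_subset_of_nonneg (Finset.subset_univ _) fun I _ _ => abs_nonneg _)
    have h4 := congrArg (l * ·) h1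
    simp only [mul_add, mul_one] at h4
    simp only [Pi.sub_apply, Pi.smul_apply, smul_eq_mul, hf_def]
    linarith
  have hg0 : (l • triangular d - f) ∅ = 0 := by simp [triangular_empty, hf0]
  have hR := isPolytope_basePolytope hf hf0
  have hperm : l • permutahedron d = basePolytope (l • triangular d) := by
    rw [permutahedron_eq_basePolytope,
      smul_basePolytope supermodular_triangular triangular_empty hl.le]
  refine ⟨basePolytope f, (signedSumDefines_iff y _).2 ⟨hR, ?_⟩, hR, l, hl, hR, ?_,
    basePolytope (l • triangular d - f), isPolytope_basePolytope hg hg0, ?_⟩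
  · rw [basePolytope_add hf hf0 (supermodular_sum_smul_simplexFunction hneg)
      (sum_smul_simplexFunction_empty _ _)]
    congr 1
    funext J
    have := sum_pos_sub_sum_neg y J
    simp only [Pi.add_apply, hf_def]
    linarith
  · rw [hperm]
    exact isPolytope_basePolytope (supermodular_triangular.smul hl.le) (by simp [triangular_empty])
  · rw [hperm, basePolytope_add hg hg0 hf hf0, sub_add_cancel]

/-- The lower support function of `R` on indicator vectors is `f = zeta y - zeta y ∅`. As `R` is a
summand of `l Π_d`, some `r ∈ R` minimizes `I ∩ J` and `I ∪ J` simultaneously, so that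
`f (I ∩ J) + f (I ∪ J) = r(I) + r(J) ≥ f I + f J`. -/
lemma supermodular_of_definesGeneralizedPermutahedron {y : Finset (Fin d) → ℝ}
    (hy : DefinesGeneralizedPermutahedron y) : Supermodular (zeta y) := by
  obtain ⟨R, hR, -, l, hl, -, -, P, -, hPR⟩ := hy
  have hsum := ((signedSumDefines_iff y R).1 hR).2
  set p := ∑ I with y I < 0, (-y I) • simplexFunction I with hp_def
  set q := ∑ I with 0 ≤ y I, y I • simplexFunction I with hq_def
  have hp : Supermodular p := supermodular_sum_smul_simplexFunction
    fun I hI => (neg_pos.2 (Finset.mem_filter.1 hI).2).le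
  have hq : Supermodular q := supermodular_sum_smul_simplexFunction
    fun I hI => (Finset.mem_filter.1 hI).2
  have hp0 : p ∅ = 0 := sum_smul_simplexFunction_empty _ _
  have hq0 : q ∅ = 0 := sum_smul_simplexFunction_empty _ _
  have hpq : ∀ J, q J - p J = zeta y J - zeta y ∅ := sum_pos_sub_sum_neg y
  have hlower : ∀ r ∈ R, ∀ J, q J - p J ≤ ∑ i ∈ J, r i := by
    intro r hr J
    obtain ⟨x, hx, hxJ, -⟩ := exists_mem_basePolytope_tight hp hp0 (subset_refl J)
    have h := (hsum ▸ Set.add_mem_add hr hx : r + x ∈ basePolytope q).2 J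
    simp only [Pi.add_apply, Finset.sum_add_distrib, hxJ] at h
    linarith
  have hattained : ∀ J, ∃ r ∈ R, ∑ i ∈ J, r i ≤ q J - p J := by
    intro J
    obtain ⟨x, hx, hxJ, -⟩ := exists_mem_basePolytope_tight hq hq0 (subset_refl J)
    rw [← hsum] at hx
    obtain ⟨r, hr, s, hs, rfl⟩ := hx
    have h := hs.2 J
    simp only [Pi.add_apply, Finset.sum_add_distrib] at hxJ
    exact ⟨r, hr, by linarith⟩
  rw [permutahedron_eq_basePolytope,
    smul_basePolytope supermodular_triangular triangular_empty hl.le] at hPR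
  intro I J
  obtain ⟨x, hx, h1, h2⟩ := exists_mem_basePolytope_tight
    (supermodular_triangular.smul hl.le) (by simp [triangular_empty])
    (Finset.inter_subset_left.trans Finset.subset_union_left : I ∩ J ⊆ I ∪ J)
  rw [← hPR] at hx
  obtain ⟨s, hs, r, hr, rfl⟩ := hx
  have hmin : ∀ K, ∑ i ∈ K, (s + r) i = (l • triangular d) K → ∑ i ∈ K, r i ≤ q K - p K := by
    intro K hK
    obtain ⟨r', hr', hle⟩ := hattained K
    have h := (hPR ▸ Set.add_mem_add hs hr' : s + r' ∈ basePolytope (l • triangular d)).2 K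
    rw [← hK] at h
    simp only [Pi.add_apply, Finset.sum_add_distrib] at h
    linarith
  have a1 := hmin _ h1
  have a2 := hmin _ h2
  have a3 := hlower r hr I
  have a4 := hlower r hr J
  have a5 := Finset.sum_union_inter (s₁ := I) (s₂ := J) (f := r)
  rw [hpq] at a1 a2 a3 a4
  linarith

lemma definesGeneralizedPermutahedron_iff (y : Finset (Fin d) → ℝ) :
    DefinesGeneralizedPermutahedron y ↔ Supermodular (zeta y) :=
  ⟨supermodular_of_definesGeneralizedPermutahedron,
    definesGeneralizedPermutahedron_of_supermodular⟩

/-! ### Facets of the coefficient cone -/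

/-- The index set of the facets: pairs `E ⊆ T` with `|E| = 2`. -/
abbrev FacetIndex (d : ℕ) : Type :=
  {p : Finset (Fin d) × Finset (Fin d) // p.1.card = 2 ∧ p.1 ⊆ p.2}

/-- The linear form `y ↦ ∑_{E ⊆ I ⊆ T} y_I`. -/
def intervalSum (p : FacetIndex d) : Module.Dual ℝ (Finset (Fin d) → ℝ) :=
  ∑ I ∈ Finset.Icc p.1.1 p.1.2, LinearMap.proj I

lemma intervalSum_apply (p : FacetIndex d) (y : Finset (Fin d) → ℝ) :
    intervalSum p y = ∑ I ∈ Finset.Icc p.1.1 p.1.2, y I := by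
  simp [intervalSum]

/-- The cone of coefficient vectors. -/
noncomputable def coefficientCone (d : ℕ) : PointedCone ℝ (Finset (Fin d) → ℝ) :=
  PointedCone.map (moebius d) (supermodularCone d)

lemma mem_coefficientCone_iff_supermodular {y : Finset (Fin d) → ℝ} :
    y ∈ coefficientCone d ↔ Supermodular (zeta y) := by
  rw [coefficientCone, PointedCone.mem_map]
  constructor
  · rintro ⟨z, hz, rfl⟩
    rw [zeta_moebius]
    exact hz
  · exact fun h => ⟨zeta y, h, moebius_zeta y⟩

lemma mem_coefficientCone {y : Finset (Fin d) → ℝ} :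
    y ∈ coefficientCone d ↔ ∀ p : FacetIndex d, 0 ≤ intervalSum p y := by
  rw [mem_coefficientCone_iff_supermodular, supermodular_zeta_iff]
  constructor
  · exact fun h p => by rw [intervalSum_apply]; exact h _ _ p.2.1 p.2.2
  · exact fun h E T hE hET => by
      have := h ⟨(E, T), hE, hET⟩
      rwa [intervalSum_apply] at this

lemma intervalSum_one_pos (p : FacetIndex d) : 0 < intervalSum p 1 := by
  rw [intervalSum_apply]
  exact Finset.sum_pos (fun _ _ => one_pos) ⟨p.1.1, Finset.left_mem_Icc.2 p.2.2⟩

/-- Raise `triangular` by `1/2` at the two middle vertices of the square of `(E, T)`, i.e. at the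
sets `T \ {i}` with `i ∈ E`. The second difference along this square drops from `1` to `0`. A
different square has at most one of these two sets as a middle vertex, so its second difference
stays at least `1/2`. -/
lemma exists_intervalSum_eq_zero (p : FacetIndex d) :
    ∃ y : Finset (Fin d) → ℝ, intervalSum p y = 0 ∧ ∀ q, q ≠ p → 0 < intervalSum q y := by
  obtain ⟨⟨E, T⟩, hE, hET⟩ := p
  obtain ⟨A, i, j, hi, hj, hij, rfl, rfl⟩ := exists_eq_insert_insert hE hET
  let b : Finset (Fin d) → ℝ := fun S => if S = insert i A ∨ S = insert j A then 1 / 2 else 0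
  have hb0 : ∀ S, 0 ≤ b S := fun S => by simp only [b]; split_ifs <;> norm_num
  have hb1 : ∀ S, b S ≤ 1 / 2 := fun S => by simp only [b]; split_ifs <;> norm_num
  have hcard : ∀ S, S.card ≠ A.card + 1 → b S = 0 := fun S hS => if_neg fun h => by
    rcases h with rfl | rfl
    · exact hS (Finset.card_insert_of_notMem hi)
    · exact hS (Finset.card_insert_of_notMem hj)
  refine ⟨moebius d (triangular d + b), ?_, fun q hq => ?_⟩
  · rw [intervalSum_apply, sum_Icc_insert _ hi hj hij, zeta_moebius]
    have h := triangular_insert_insert hi hj hij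
    have h1 : b (insert i A) = 1 / 2 := if_pos (Or.inl rfl)
    have h2 : b (insert j A) = 1 / 2 := if_pos (Or.inr rfl)
    have h3 : b A = 0 := hcard A (by omega)
    have h4 : b (insert i (insert j A)) = 0 := hcard _ (by
      rw [Finset.card_insert_of_notMem (by simp [hij, hi]), Finset.card_insert_of_notMem hj]
      omega)
    simp only [Pi.add_apply, h1, h2, h3, h4]
    linarith
  · obtain ⟨⟨E', T'⟩, hE', hET'⟩ := q
    obtain ⟨B, k, m, hk, hm, hkm, rfl, rfl⟩ := exists_eq_insert_insert hE' hET'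
    rw [intervalSum_apply, sum_Icc_insert _ hk hm hkm, zeta_moebius]
    have h := triangular_insert_insert hk hm hkm
    have h0 := hb0 B
    have h0' := hb0 (insert k (insert m B))
    suffices b (insert k B) + b (insert m B) ≤ 1 / 2 by
      simp only [Pi.add_apply]
      linarith
    by_cases hkb : insert k B = insert i A ∨ insert k B = insert j A
    · by_cases hmb : insert m B = insert i A ∨ insert m B = insert j A
      · -- both middle vertices are raised: then the two squares coincide
        exfalso
        have hne : insert k B ≠ insert m B := fun h => by
          have : k ∈ insert m B := h ▸ Finset.mem_insert_self k B
          simp [hkm, hk] at this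
        have hBi : insert k B ∪ insert m B = insert i A ∪ insert j A ∧
            insert k B ∩ insert m B = insert i A ∩ insert j A := by
          rcases hkb with h1 | h1 <;> rcases hmb with h2 | h2
          · exact absurd (h1.trans h2.symm) hne
          · rw [h1, h2]; exact ⟨rfl, rfl⟩
          · rw [h1, h2]; exact ⟨Finset.union_comm _ _, Finset.inter_comm _ _⟩
          · exact absurd (h1.trans h2.symm) hne
        have hpair : ∀ (D : Finset (Fin d)) (a c : Fin d), a ∉ D → c ∉ D →
            insert a (insert c D) \ D = {a, c} := fun D a c ha hc => by
          ext x
          simp only [Finset.mem_sdiff, Finset.mem_insert, Finset.mem_singleton]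
          constructor
          · tauto
          · rintro (rfl | rfl) <;> tauto
        rw [insert_union_insert, insert_union_insert, insert_inter_insert hk hm hkm,
          insert_inter_insert hi hj hij] at hBi
        apply hq
        have hE : ({k, m} : Finset (Fin d)) = {i, j} := by
          rw [← hpair B k m hk hm, ← hpair A i j hi hj, hBi.1, hBi.2]
        exact Subtype.ext (Prod.ext hE hBi.1)
      · rw [show b (insert m B) = 0 from if_neg hmb, add_zero]
        exact hb1 _
    · rw [show b (insert k B) = 0 from if_neg hkb, zero_add]
      exact hb1 _

lemma coe_zeroFace_intervalSum (p : FacetIndex d) :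
    (zeroFace (coefficientCone d) (intervalSum p) : Set (Finset (Fin d) → ℝ)) =
      {y | y ∈ coefficientCone d ∧ ∑ I ∈ Finset.Icc p.1.1 p.1.2, y I = 0} := by
  ext y
  rw [SetLike.mem_coe, mem_zeroFace, intervalSum_apply, Set.mem_ofPred_eq]

end GenPerm

theorem theorem2p3 (d : ℕ) :
    -- the characterization of the coefficient vectors
    (∀ y : Finset (Fin d) → ℝ,
      GenPerm.DefinesGeneralizedPermutahedron y ↔
        ∀ E T : Finset (Fin d), E.card = 2 → E ⊆ T → 0 ≤ ∑ I ∈ Finset.Icc E T, y I) ∧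
    -- the coefficient vectors form a polyhedral cone
    ∃ C : PointedCone ℝ (Finset (Fin d) → ℝ),
      (C : Set (Finset (Fin d) → ℝ)) = {y | GenPerm.DefinesGeneralizedPermutahedron y} ∧
      GenPerm.IsPolyhedral C ∧
      -- each inequality defines a facet
      (∀ E T : Finset (Fin d), E.card = 2 → E ⊆ T →
        ∃ F : PointedCone ℝ (Finset (Fin d) → ℝ), GenPerm.IsFacetOf F C ∧
          (F : Set (Finset (Fin d) → ℝ)) = {y | y ∈ C ∧ ∑ I ∈ Finset.Icc E T, y I = 0}) ∧
      -- each facet is defined by exactly one of the inequalities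
      (∀ F : PointedCone ℝ (Finset (Fin d) → ℝ), GenPerm.IsFacetOf F C →
        ∃! p : Finset (Fin d) × Finset (Fin d), p.1.card = 2 ∧ p.1 ⊆ p.2 ∧
          (F : Set (Finset (Fin d) → ℝ)) = {y | y ∈ C ∧ ∑ I ∈ Finset.Icc p.1 p.2, y I = 0}) ∧
      -- the cone is the image of the supermodular cone under the linear bijection `moebius d`
      Function.Bijective (GenPerm.moebius d) ∧
      C = PointedCone.map (GenPerm.moebius d) (GenPerm.supermodularCone d) := by
  open GenPerm in
  choose x hx0 hxpos using exists_intervalSum_eq_zero (d := d)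
  have hC : ∀ y, y ∈ coefficientCone d ↔ ∀ p, 0 ≤ intervalSum p y := fun y => mem_coefficientCone
  refine ⟨fun y => by rw [definesGeneralizedPermutahedron_iff, supermodular_zeta_iff],
    coefficientCone d, ?_, isPolyhedral_of_mem_iff hC, ?_, ?_, moebius_bijective d, rfl⟩
  · ext y
    rw [SetLike.mem_coe, mem_coefficientCone_iff_supermodular, Set.mem_ofPred_eq,
      definesGeneralizedPermutahedron_iff]
  · intro E T hE hET
    exact ⟨_, isFacetOf_zeroFace hC intervalSum_one_pos (hx0 ⟨(E, T), hE, hET⟩) (hxpos _),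
      coe_zeroFace_intervalSum ⟨(E, T), hE, hET⟩⟩
  · intro F hF
    obtain ⟨p, rfl⟩ := hF.exists_eq_zeroFace hC intervalSum_one_pos
    refine ⟨p.1, ⟨p.2.1, p.2.2, coe_zeroFace_intervalSum p⟩, ?_⟩
    rintro q ⟨hq, hq', h⟩
    have h' : zeroFace (coefficientCone d) (intervalSum p) =
        zeroFace (coefficientCone d) (intervalSum ⟨q, hq, hq'⟩) :=
      SetLike.coe_injective (h.trans (coe_zeroFace_intervalSum ⟨q, hq, hq'⟩).symm)
    exact (congrArg Subtype.val (zeroFace_injective hC hx0 hxpos h')).symm
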